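/- Theorem (multilabeled Sperner's lemma). Let $n\ge 1$ and $m$ be natural numbers, let $p_1,\ldots,p_n$ be affinely independent points of a Euclidean space, and let $\Delta^{n-1}=\operatorname{conv}(\{p_1,\ldots,p_n\})$. Let $T$ be a triangulation of $\Delta^{n-1}$, that is, a finite collection of simplices with union $\Delta^{n-1}$ that contains every face of each of its simplices and in which any two simplices are disjoint or meet in a common face. Let $\lambda_1,\ldots,\lambda_m$ be Sperner labelings of $T$: each $\lambda_i$ assigns to every vertex of $T$ a label in $\{1,\ldots,n\}$ such that, for every $S\subseteq\{1,\ldots,n\}$, each vertex of $T$ lying in the face $\operatorname{conv}\{p_j : j\in S\}$ receives a label from $S$. Then: (1) for any positive integers $k_1,\ldots,k_m$ with $k_1+\cdots+k_m=m+n-1$ there is a simplex $\sigma\in T$ such that, for each $i\in\{1,\ldots,m\}$, the labeling $\lambda_i$ uses at least $k_i$ distinct labels on the vertices of $\sigma$; (2) for any positive integers $l_1,\ldots,l_n$ with $l_1+\cdots+l_n=m+n-1$ there is a simplex $\tau\in T$ such that, for each $j\in\{1,\ldots,n\}$, at least $l_j$ of the labelings $\lambda_1,\ldots,\lambda_m$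 use the label $j$ on some vertex of $\tau$. -/

import Mathlib

namespace MultiSperner

variable {E : Type*} [NormedAddCommGroup E] [InnerProductSpace ℝ E]

/-- `K` is a (finite) triangulation of the set `P`: a finite simplicial complex (finitely many
simplices, closed under taking faces, any two meeting in a common face or not at all) whose
simplices have union `P`. -/
structure IsTriangulation (K : Geometry.SimplicialComplex ℝ E) (P : Set E) : Prop where
  finite_faces : K.faces.Finite
  space_eq : K.space = P

/-- A labeling of the vertices of `K` by `n` labels is a Sperner labeling, with respect to the
simplex with vertices `p 0, …, p (n - 1)`, if each vertex of `K` that lies in the face spanned by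
`p j`, `j ∈ S`, receives a label from `S`. -/
def IsSpernerLabeling {n : ℕ} (p : Fin n → E) (K : Geometry.SimplicialComplex ℝ E)
    (lab : K.vertices → Fin n) : Prop :=
  ∀ (v : K.vertices) (S : Set (Fin n)), (v : E) ∈ convexHull ℝ (p '' S) → lab v ∈ S

/-- The set of labels that the labeling `lab` uses on the simplex with vertex set `s`. -/
def labelsOn {n : ℕ} {K : Geometry.SimplicialComplex ℝ E} (lab : K.vertices → Fin n)
    (s : Finset E) : Set (Fin n) :=
  {j | ∃ v : K.vertices, (v : E) ∈ s ∧ lab v = j}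

end MultiSperner

/-!
The engine is a closed covering theorem on the standard simplex without boundary conditions: if
closed sets `A i` cover it, some point `x` satisfies `x ∈ A i` whenever `x i ≠ 0`. It follows from
the combinatorial lemma of Scarf, a parity count, applied to a fine finite net of the simplex whose
points are compared coordinate by coordinate: a dominant set carries all the colours of some set
`C`, and on a fine net it has small diameter while its points have small coordinates outside `C`.

A Sperner labeling sends each vertex of `T` to a unit vector; extended affinely over the simplices
of `T` it gives a self-map of the simplex preserving every face. For weights `r i ≥ 0` with the same
sum as `y ≥ 0`, let `G` be the sum of these maps with weights `r i`. The sets where `G j ≤ y j`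
cover the simplex, and the `j`-th one contains the facet where the `j`-th coordinate vanishes. So
the covering theorem produces a point with `G ≤ y`, that is, `G = y`. At this point, in a simplex
`σ`, the contributions of the labelings form a nonnegative matrix with row sums `r i` and column
sums `y j`, whose nonzero entries mark labels used on `σ`. If the entries are at most `1`, a row or
column sum exceeding `k - 1` forces at least `k` nonzero entries. The first part takes column sums
slightly below `1` and row sums slightly above `k i - 1`; the second takes row sums `1` and column
sums `l j - 1 + 1 / n`.
-/

namespace MultiSperner

section Scarf

open Finset

theorem card_filter_image_erase_eq_two {β γ : Type*} [DecidableEq β] [DecidableEq γ] {s : Finset β}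
    {g : β → γ} (h : #(s.image g) + 1 = #s) :
    #{x ∈ s | (s.erase x).image g = s.image g} = 2 := by
  obtain ⟨a, ha, b, hb, hab, hgab⟩ :=
    exists_ne_map_eq_of_card_lt_of_maps_to (t := s.image g) (by omega)
      fun x hx ↦ mem_image_of_mem g hx
  refine card_eq_two.2 ⟨a, b, hab, ?_⟩
  ext x
  simp only [mem_filter, mem_insert, mem_singleton]
  constructor
  · rintro ⟨hx, himage⟩
    by_contra! hxab
    have hinj : Set.InjOn g (s.erase x) := by
      rw [← card_image_iff, himage, card_erase_of_mem hx]
      omega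
    exact hab (hinj (mem_coe.2 (mem_erase.2 ⟨hxab.1.symm, ha⟩))
      (mem_coe.2 (mem_erase.2 ⟨hxab.2.symm, hb⟩)) hgab)
  · have himage (x y : β) (hxy : x ≠ y) (hx : x ∈ s) (hy : y ∈ s) (hg : g x = g y) :
        (s.erase x).image g = s.image g := by
      conv_rhs => rw [← insert_erase hx, image_insert, hg]
      exact (insert_eq_of_mem (mem_image_of_mem g (mem_erase.2 ⟨hxy.symm, hy⟩))).symm
    rintro (rfl | rfl)
    · exact ⟨ha, himage x b hab ha hb hgab⟩
    · exact ⟨hb, himage x a hab.symm hb ha hgab.symm⟩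

section Dominant

variable {ι V α : Type*} [LinearOrder α]

/-- A set `R` of points, compared through the preorders induced by the functions `f i`, is dominant
if no point exceeds some element of `R` in every one of them. These are the sets of Scarf's
lemma. -/
def Dominant (f : ι → V → α) (R : Finset V) : Prop :=
  ∀ y, ∃ i, ∀ x ∈ R, f i y ≤ f i x

/-- `m i` is an element of `R` minimising `f i`. -/
def IsMinChoice (f : ι → V → α) (R : Finset V) (m : ι → V) : Prop :=
  ∀ i, m i ∈ R ∧ ∀ x ∈ R, f i (m i) ≤ f i x

/-- The points exceeding `m i` in the `i`-th preorder, for every `i ≠ k`. When `m` lists the minima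
of a dominant set `R`, the maxima of such cones are the points that can be adjoined to `R`. -/
def cone (f : ι → V → α) (m : ι → V) (k : ι) : Set V :=
  {x | ∀ i, i ≠ k → f i (m i) < f i x}

variable {f : ι → V → α} {R S : Finset V} {m : ι → V} {k l : ι} {x : V}

theorem Dominant.mono (hR : Dominant f R) (hSR : S ⊆ R) : Dominant f S :=
  fun y ↦ (hR y).imp fun _ hi x hx ↦ hi x (hSR hx)

theorem exists_isMinChoice (f : ι → V → α) (hR : R.Nonempty) : ∃ m, IsMinChoice f R m := by
  choose m hm using fun i ↦ R.exists_min_image (f i) hR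
  exact ⟨m, hm⟩

theorem Dominant.eq_of_mem_cone (hR : Dominant f R) (hm : IsMinChoice f R m)
    (hk : x ∈ cone f m k) (hl : x ∈ cone f m l) : k = l := by
  obtain ⟨i, hi⟩ := hR x
  have hle : f i x ≤ f i (m i) := hi _ (hm i).1
  have hik : i = k := by_contra fun h ↦ (hk i h).not_ge hle
  have hil : i = l := by_contra fun h ↦ (hl i h).not_ge hle
  exact hik.symm.trans hil

variable [DecidableEq V]

theorem Dominant.insert_of_isMaxOn (hR : Dominant f R) (hm : IsMinChoice f R m)
    (hx : x ∈ cone f m k) (hmax : IsMaxOn (f k) (cone f m k) x) : Dominant f (insert x R) := by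
  intro y
  by_cases hy : y ∈ cone f m k
  · obtain ⟨i, hi⟩ := hR y
    obtain rfl : i = k := by_contra fun h ↦ (hy i h).not_ge (hi _ (hm i).1)
    exact ⟨i, forall_mem_insert _ _ _ |>.2 ⟨hmax hy, hi⟩⟩
  · obtain ⟨i, hik, hi⟩ : ∃ i, i ≠ k ∧ f i y ≤ f i (m i) := by simpa [cone] using hy
    exact ⟨i, forall_mem_insert _ _ _ |>.2
      ⟨hi.trans (hx i hik).le, fun z hz ↦ hi.trans ((hm i).2 z hz)⟩⟩

variable [Fintype ι]

theorem Dominant.image_minChoice (hf : ∀ i, Function.Injective (f i)) (hR : Dominant f R)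
    (hm : IsMinChoice f R m) : univ.image m = R := by
  refine (image_subset_iff.2 fun i _ ↦ (hm i).1).antisymm fun x hx ↦ ?_
  obtain ⟨i, hi⟩ := hR x
  exact mem_image.2 ⟨i, mem_univ i, hf i (((hm i).2 x hx).antisymm (hi _ (hm i).1))⟩

theorem notMem_of_mem_cone [DecidableEq ι] (hk : (univ.erase k).image m = R)
    (hx : x ∈ cone f m k) : x ∉ R := by
  rw [← hk, mem_image]
  rintro ⟨i, hi, rfl⟩
  exact (hx i (ne_of_mem_erase hi)).false

theorem exists_isMaxOn_cone [DecidableEq ι] (hf : ∀ i, Function.Injective (f i))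
    (hcard : #R + 1 = Fintype.card ι) (hm : IsMinChoice f R m) (hxR : x ∉ R)
    (hx : Dominant f (insert x R)) :
    ∃ k, (univ.erase k).image m = R ∧ x ∈ cone f m k ∧ IsMaxOn (f k) (cone f m k) x := by
  obtain ⟨M, hM⟩ := exists_isMinChoice f (insert_nonempty x R)
  have hMimage : univ.image M = insert x R := hx.image_minChoice hf hM
  have hMinj : Function.Injective M := by
    rw [← Set.injOn_univ, ← coe_univ, ← card_image_iff, hMimage, card_insert_of_notMem hxR, hcard,
      card_univ]
  obtain ⟨k, -, hk⟩ := mem_image.1 (hMimage ▸ mem_insert_self x R)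
  have hMx (i : ι) (hi : i ≠ k) : M i ≠ x := fun h ↦ hi (hMinj (h.trans hk.symm))
  have hMm (i : ι) (hi : i ≠ k) : M i = m i :=
    hf i (((hM i).2 _ (mem_insert_of_mem (hm i).1)).antisymm
      ((hm i).2 _ (mem_of_mem_insert_of_ne (hM i).1 (hMx i hi))))
  refine ⟨k, ?_, fun i hi ↦ ?_, fun y hy ↦ ?_⟩
  · calc (univ.erase k).image m = (univ.erase k).image M :=
          image_congr fun i hi ↦ (hMm i (ne_of_mem_erase hi)).symm
      _ = R := by rw [image_erase hMinj, hMimage, hk, erase_insert hxR]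
  · rw [← hMm i hi]
    exact lt_of_le_of_ne ((hM i).2 x (mem_insert_self x R)) fun h ↦ hMx i hi (hf i h)
  · obtain ⟨i, hi⟩ := hx y
    obtain rfl : i = k := by_contra fun h ↦ (hy i h).not_ge (hi _ (mem_insert_of_mem (hm i).1))
    exact hi x (mem_insert_self x R)

open scoped Classical in
theorem Dominant.card_extensions_eq_two [Fintype V] (hf : ∀ i, Function.Injective (f i))
    (hR : Dominant f R) (hcard : #R + 1 = Fintype.card ι) (hm : IsMinChoice f R m)
    (hcone : ∀ k, (cone f m k).Nonempty) : #{x | x ∉ R ∧ Dominant f (insert x R)} = 2 := by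
  have hmR : univ.image m = R := hR.image_minChoice hf hm
  choose b hb hbmax using fun k ↦ Set.exists_max_image _ (f k) (cone f m k).toFinite (hcone k)
  rw [← card_filter_image_erase_eq_two (s := univ) (g := m) (by rw [hmR, hcard, card_univ]), hmR]
  refine (card_bij (fun k _ ↦ b k) (fun k hk ↦ ?_) (fun k _ l _ hkl ↦ ?_) fun x hx ↦ ?_).symm
  · simp only [mem_filter, mem_univ, true_and] at hk ⊢
    exact ⟨notMem_of_mem_cone hk (hb k), hR.insert_of_isMaxOn hm (hb k) (hbmax k)⟩
  · exact hR.eq_of_mem_cone hm (hb k) (hkl ▸ hb l)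
  · obtain ⟨hxR, hx⟩ := (mem_filter.1 hx).2
    obtain ⟨k, hk, hxk, hxmax⟩ := exists_isMaxOn_cone hf hcard hm hxR hx
    exact ⟨k, by simpa using hk, hf k ((hxmax (hb k)).antisymm (hbmax k x hxk))⟩

end Dominant

section RoomsAndDoors

variable {ι V α : Type*} [LinearOrder α]

/-- `s i` is the least point of the `i`-th preorder, and exceeds in all other preorders the points
that are not of the form `s j`. Such points stand for the facets of the simplex. -/
structure IsSlack (f : ι → V → α) (s : ι → V) : Prop where
  le : ∀ i v, f i (s i) ≤ f i v
  lt : ∀ {v}, v ∉ Set.range s → ∀ i j, i ≠ j → f i v < f i (s j)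

variable {f : ι → V → α} {c : V → ι} {i₀ : ι} {s : ι → V} {R D : Finset V} [Fintype ι]

open scoped Classical in
/-- The dominant sets with as many elements as there are preorders: the nodes of the parity
argument. -/
noncomputable def rooms [Fintype V] (f : ι → V → α) : Finset (Finset V) :=
  {R | #R = Fintype.card ι ∧ Dominant f R}

theorem mem_rooms [Fintype V] : R ∈ rooms f ↔ #R = Fintype.card ι ∧ Dominant f R := by
  simp [rooms]

open scoped Classical in
/-- The dominant sets with exactly one element of every colour other than `i₀`: the edges of the
parity argument, a door joining the rooms that contain it. -/
noncomputable def doors [Fintype V] [DecidableEq ι] (f : ι → V → α) (c : V → ι) (i₀ : ι) :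
    Finset (Finset V) :=
  {D | #D + 1 = Fintype.card ι ∧ Dominant f D ∧ D.image c = univ.erase i₀}

theorem mem_doors [Fintype V] [DecidableEq ι] : D ∈ doors f c i₀ ↔
    #D + 1 = Fintype.card ι ∧ Dominant f D ∧ D.image c = univ.erase i₀ := by
  simp [doors]

variable [DecidableEq ι] [DecidableEq V]

theorem image_eq_univ_of_odd_card_filter (hR : #R = Fintype.card ι)
    (hodd : Odd #{x ∈ R | (R.erase x).image c = univ.erase i₀}) : R.image c = univ := by
  by_contra hne
  obtain ⟨x, hx⟩ := card_pos.1 hodd.pos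
  have himage : R.image c = univ.erase i₀ := by
    refine subset_antisymm (fun i hi ↦ mem_erase.2 ⟨?_, mem_univ i⟩) ?_
    · rintro rfl
      refine hne (univ_subset_iff.1 ?_)
      rw [← insert_erase (mem_univ i), insert_subset_iff, ← (mem_filter.1 hx).2]
      exact ⟨hi, image_subset_image (erase_subset x R)⟩
    · exact (mem_filter.1 hx).2 ▸ image_subset_image (erase_subset x R)
  have hcard : #(R.image c) + 1 = #R := by
    rw [himage, card_erase_add_one (mem_univ i₀), hR, card_univ]
  rw [← himage, card_filter_image_erase_eq_two hcard] at hodd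
  exact absurd hodd (by decide)

/-- The door whose elements are the slack points other than `s i₀`; it lies in a single room. -/
def outerDoor (s : ι → V) (i₀ : ι) : Finset V :=
  (univ.erase i₀).image s

theorem mem_outerDoor {x : V} : x ∈ outerDoor s i₀ ↔ ∃ i, i ≠ i₀ ∧ s i = x := by
  simp [outerDoor]

theorem card_outerDoor_add_one (hs : Function.Injective s) :
    #(outerDoor s i₀) + 1 = Fintype.card ι := by
  rw [outerDoor, card_image_of_injective _ hs, card_erase_add_one (mem_univ i₀), card_univ]

theorem IsSlack.dominant_insert_outerDoor (hs : IsSlack f s) {v : V}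
    (hmax : ∀ y ∉ Set.range s, f i₀ y ≤ f i₀ v) : Dominant f (insert v (outerDoor s i₀)) := by
  intro y
  by_cases hy : y ∈ Set.range s
  · obtain ⟨i, rfl⟩ := hy
    exact ⟨i, fun x _ ↦ hs.le i x⟩
  · refine ⟨i₀, forall_mem_insert _ _ _ |>.2 ⟨hmax y hy, fun x hx ↦ ?_⟩⟩
    obtain ⟨i, hi, rfl⟩ := mem_outerDoor.1 hx
    exact (hs.lt hy i₀ i hi.symm).le

variable [Fintype V]

theorem card_doors_of_mem_rooms (hR : R ∈ rooms f) :
    #{D ∈ doors f c i₀ | D ⊆ R} = #{x ∈ R | (R.erase x).image c = univ.erase i₀} := by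
  obtain ⟨hcard, hdom⟩ := mem_rooms.1 hR
  refine (card_bij (fun x _ ↦ R.erase x) (fun x hx ↦ ?_) (fun x hx y hy ↦ ?_) fun D hD ↦ ?_).symm
  · obtain ⟨hxR, hx⟩ := mem_filter.1 hx
    exact mem_filter.2 ⟨mem_doors.2 ⟨(card_erase_add_one hxR).trans hcard,
      hdom.mono (erase_subset x R), hx⟩, erase_subset x R⟩
  · exact erase_injOn R (mem_filter.1 hx).1 (mem_filter.1 hy).1
  · obtain ⟨hD, hDR⟩ := mem_filter.1 hD
    obtain ⟨hDcard, -, hDimage⟩ := mem_doors.1 hD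
    obtain ⟨x, hxD, rfl⟩ := exists_eq_insert_iff.2 ⟨hDR, hDcard.trans hcard.symm⟩
    have hx : (insert x D).erase x = D := erase_insert hxD
    exact ⟨x, mem_filter.2 ⟨mem_insert_self x D, hx.symm ▸ hDimage⟩, hx⟩

open scoped Classical in
theorem card_rooms_of_mem_doors (hD : D ∈ doors f c i₀) :
    #{R ∈ rooms f | D ⊆ R} = #{x | x ∉ D ∧ Dominant f (insert x D)} := by
  obtain ⟨hcard, -, -⟩ := mem_doors.1 hD
  refine (card_bij (fun x _ ↦ insert x D) (fun x hx ↦ ?_) (fun x hx y _ ↦ ?_) fun R hR ↦ ?_).symm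
  · obtain ⟨hxD, hx⟩ := (mem_filter.1 hx).2
    exact mem_filter.2 ⟨mem_rooms.2 ⟨(card_insert_of_notMem hxD).trans hcard, hx⟩,
      subset_insert x D⟩
  · exact (insert_inj (mem_filter.1 hx).2.1).1
  · obtain ⟨hR, hDR⟩ := mem_filter.1 hR
    obtain ⟨hRcard, hRdom⟩ := mem_rooms.1 hR
    obtain ⟨x, hxD, rfl⟩ := exists_eq_insert_iff.2 ⟨hDR, hcard.trans hRcard.symm⟩
    exact ⟨x, by simp [hxD, hRdom], rfl⟩

theorem IsSlack.outerDoor_mem_doors (hs : IsSlack f s) (hV : ∃ v, v ∉ Set.range s)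
    (hc : Function.LeftInverse c s) : outerDoor s i₀ ∈ doors f c i₀ := by
  obtain ⟨v, -, hv⟩ := Set.exists_max_image (Set.range s)ᶜ (f i₀) (Set.toFinite _) hV
  refine mem_doors.2 ⟨card_outerDoor_add_one hc.injective,
    (hs.dominant_insert_outerDoor hv).mono (subset_insert _ _), ?_⟩
  rw [outerDoor, image_image, hc.comp_eq_id, image_id]

theorem IsSlack.card_rooms_outerDoor (hf : ∀ i, Function.Injective (f i)) (hs : IsSlack f s)
    (hV : ∃ v, v ∉ Set.range s) (hc : Function.LeftInverse c s) :
    #{R ∈ rooms f | outerDoor s i₀ ⊆ R} = 1 := by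
  obtain ⟨v, hv, hvmax⟩ := Set.exists_max_image (Set.range s)ᶜ (f i₀) (Set.toFinite _) hV
  have hs_lt (i : ι) : f i (s i) < f i v :=
    lt_of_le_of_ne (hs.le i v) fun h ↦ hv ⟨i, hf i h⟩
  rw [card_rooms_of_mem_doors (hs.outerDoor_mem_doors hV hc), card_eq_one]
  refine ⟨v, ?_⟩
  ext x
  simp only [mem_filter, mem_univ, true_and, mem_singleton]
  constructor
  · rintro ⟨hxD, hx⟩
    obtain ⟨i, hi⟩ := hx v
    obtain ⟨hvx, hiD⟩ := (forall_mem_insert _ _ _).1 hi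
    obtain rfl : i = i₀ := by_contra fun h ↦
      (hs_lt i).not_ge (hiD _ (mem_outerDoor.2 ⟨i, h, rfl⟩))
    have hxs : x ∉ Set.range s := by
      rintro ⟨j, rfl⟩
      obtain rfl : j = i := by_contra fun h ↦ hxD (mem_outerDoor.2 ⟨j, h, rfl⟩)
      exact (hs_lt j).not_ge hvx
    exact hf i ((hvmax x hxs).antisymm hvx)
  · rintro rfl
    refine ⟨fun h ↦ ?_, hs.dominant_insert_outerDoor hvmax⟩
    obtain ⟨i, -, hi⟩ := mem_outerDoor.1 h
    exact hv ⟨i, hi⟩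

theorem IsSlack.card_rooms_of_ne_outerDoor (hf : ∀ i, Function.Injective (f i)) (hs : IsSlack f s)
    (hc : Function.LeftInverse c s) (hD : D ∈ doors f c i₀) (hne : D ≠ outerDoor s i₀) :
    #{R ∈ rooms f | D ⊆ R} = 2 := by
  obtain ⟨hcard, hdom, himage⟩ := mem_doors.1 hD
  obtain ⟨v, hvD, hv⟩ : ∃ v ∈ D, v ∉ Set.range s := by
    by_contra! h
    refine hne (eq_of_subset_of_card_le (fun x hx ↦ ?_) ?_)
    · obtain ⟨i, rfl⟩ := h x hx
      have hi : i ∈ univ.erase i₀ := by simpa [himage, hc i] using mem_image_of_mem c hx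
      exact mem_outerDoor.2 ⟨i, ne_of_mem_erase hi, rfl⟩
    · have := card_outerDoor_add_one (i₀ := i₀) hc.injective
      omega
  obtain ⟨m, hm⟩ := exists_isMinChoice f ⟨v, hvD⟩
  rw [card_rooms_of_mem_doors hD, hdom.card_extensions_eq_two hf hcard hm fun k ↦ ⟨s k, fun i hi ↦
    ((hm i).2 v hvD).trans_lt (hs.lt hv i k hi)⟩]

end RoomsAndDoors

section SlackExtension

variable {ι V α : Type*} [LinearOrder α]

theorem exists_dominant_image_eq_univ [Fintype ι] [DecidableEq ι] [Finite V] {f : ι → V → α}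
    {s : ι → V} {c : V → ι} (hf : ∀ i, Function.Injective (f i)) (hs : IsSlack f s)
    (hV : ∃ v, v ∉ Set.range s) (hc : Function.LeftInverse c s) :
    ∃ R : Finset V, Dominant f R ∧ R.image c = univ := by
  classical
  have := Fintype.ofFinite V
  have ⟨v, _⟩ := hV
  have hodd : Odd (∑ R ∈ rooms f, #{D ∈ doors f c (c v) | D ⊆ R}) := by
    have hcount : ∑ R ∈ rooms f, #{D ∈ doors f c (c v) | D ⊆ R} =
        ∑ D ∈ doors f c (c v), #{R ∈ rooms f | D ⊆ R} := by
      simpa only [card_filter] using sum_comm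
    rw [hcount, ← add_sum_erase _ _ (hs.outerDoor_mem_doors hV hc),
      hs.card_rooms_outerDoor hf hV hc]
    refine odd_one.add_even (even_sum _ fun D hD ↦ ?_)
    rw [hs.card_rooms_of_ne_outerDoor hf hc (mem_of_mem_erase hD) (ne_of_mem_erase hD)]
    exact even_two
  obtain ⟨R, hR, hRodd⟩ : ∃ R ∈ rooms f, Odd #{D ∈ doors f c (c v) | D ⊆ R} := by
    by_contra! h
    exact Nat.not_even_iff_odd.2 hodd (even_sum _ fun R hR ↦ Nat.not_odd_iff_even.1 (h R hR))
  rw [card_doors_of_mem_rooms hR] at hRodd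
  obtain ⟨hcard, hdom⟩ := mem_rooms.1 hR
  exact ⟨R, hdom, image_eq_univ_of_odd_card_filter hcard hRodd⟩

/-- The extension of `f` to points `Sum.inr j` that are slack points: `Sum.inr j` lies at the bottom
of the `j`-th preorder and at the top of all others. -/
def slackExtension [DecidableEq ι] (f : ι → V → α) (i : ι) : V ⊕ ι → WithBot (WithTop α) :=
  Sum.elim (fun v ↦ ((f i v : WithTop α) : WithBot (WithTop α))) fun j ↦
    if i = j then ⊥ else ⊤

theorem bot_lt_slackExtension [DecidableEq ι] (f : ι → V → α) {i : ι} {x : V ⊕ ι}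
    (hx : x ≠ Sum.inr i) : ⊥ < slackExtension f i x := by
  rcases x with v | j
  · exact WithBot.bot_lt_coe _
  · have hij : i ≠ j := fun h ↦ hx (h ▸ rfl)
    simp [slackExtension, hij]

theorem isSlack_toLex_slackExtension [DecidableEq ι] (f : ι → V → α) {β : Type*} [LinearOrder β]
    (e : V ⊕ ι → β) :
    IsSlack (fun i x ↦ toLex (slackExtension f i x, e x)) Sum.inr where
  le i x := by
    rcases eq_or_ne x (Sum.inr i) with rfl | hx
    · exact le_rfl
    · refine (Prod.Lex.toLex_lt_toLex.2 (.inl ?_)).le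
      simpa [slackExtension] using bot_lt_slackExtension f hx
  lt {x} hx i j hij := by
    rcases x with v | k
    · refine Prod.Lex.toLex_lt_toLex.2 (.inl ?_)
      simp only [slackExtension, Sum.elim_inl, Sum.elim_inr, if_neg hij]
      exact WithBot.coe_lt_coe.2 (WithTop.coe_lt_top (f i v))
    · exact absurd ⟨k, rfl⟩ hx

theorem exists_dominant_subset_image [Finite ι] [DecidableEq ι] [Finite V] [Nonempty V]
    (f : ι → V → α) (c : V → ι) :
    ∃ (C : Finset ι) (σ : Finset V), Dominant (fun i : C ↦ f i) σ ∧ C ⊆ σ.image c := by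
  classical
  have := Fintype.ofFinite ι
  have := Fintype.ofFinite V
  let F (i : ι) (x : V ⊕ ι) := toLex (slackExtension f i x, Fintype.equivFin (V ⊕ ι) x)
  have hF (i : ι) : Function.Injective (F i) := fun x y hxy ↦
    (Fintype.equivFin _).injective (congrArg (fun z ↦ (ofLex z).2) hxy)
  have hslack : IsSlack F Sum.inr := isSlack_toLex_slackExtension f _
  obtain ⟨R, hR, hRc⟩ := exists_dominant_image_eq_univ (c := Sum.elim c id) hF hslack
    ⟨Sum.inl (Classical.arbitrary V), by simp⟩ fun _ ↦ rfl
  refine ⟨({i | Sum.inr i ∉ R} : Finset ι), R.toLeft, fun y ↦ ?_, fun i hi ↦ ?_⟩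
  · obtain ⟨i, hi⟩ := hR (Sum.inl y)
    have hiR : Sum.inr i ∉ R := fun h ↦
      (lt_of_le_of_ne (hslack.le i _) ((hF i).ne Sum.inr_ne_inl)).not_ge (hi _ h)
    refine ⟨⟨i, by simpa using hiR⟩, fun x hx ↦ ?_⟩
    have hle := Prod.Lex.monotone_fst _ _ (hi _ (mem_toLeft.1 hx))
    simpa [F, slackExtension] using hle
  · obtain ⟨x, hx, hxi⟩ := mem_image.1 (hRc ▸ mem_univ i)
    rcases x with v | j
    · exact mem_image.2 ⟨v, mem_toLeft.2 hx, hxi⟩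
    · obtain rfl : j = i := hxi
      exact absurd hx (mem_filter.1 hi).2

end SlackExtension

end Scarf

section Covering

open Metric

variable {ι : Type*} [Fintype ι]

theorem one_le_sum_add_of_net {t : Set (ι → ℝ)} {δ : ℝ} (hδ : 0 < δ)
    (ht : ∀ z ∈ stdSimplex ℝ ι, ∃ y ∈ t, dist z y < δ) {C : Finset ι} (hC : C.Nonempty)
    {μ : ι → ℝ} (hμ : ∀ i ∈ C, 0 ≤ μ i) (htμ : ∀ y ∈ t, ∃ i ∈ C, y i ≤ μ i) :
    1 ≤ ∑ i ∈ C, (μ i + δ) := by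
  classical
  by_contra! hlt
  set s := ∑ i ∈ C, (μ i + δ)
  have hpos (i : ι) (hi : i ∈ C) : 0 < μ i + δ := add_pos_of_nonneg_of_pos (hμ i hi) hδ
  have hs : 0 < s := Finset.sum_pos hpos hC
  let z (i : ι) : ℝ := if i ∈ C then (μ i + δ) / s else 0
  have hz : z ∈ stdSimplex ℝ ι := by
    refine ⟨fun i ↦ ?_, ?_⟩
    · by_cases hi : i ∈ C
      · simpa [z, hi] using div_nonneg (hpos i hi).le hs.le
      · simp [z, hi]
    · simp only [z, Finset.sum_ite_mem, Finset.univ_inter, ← Finset.sum_div]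
      exact div_self hs.ne'
  obtain ⟨y, hyt, hzy⟩ := ht z hz
  obtain ⟨i, hi, hyi⟩ := htμ y hyt
  have hzi : μ i + δ < z i := by
    simpa only [z, if_pos hi] using (lt_div_iff₀ hs).2 (mul_lt_of_lt_one_right (hpos i hi) hlt)
  have hdist : z i - y i < δ :=
    (le_abs_self _).trans_lt ((dist_le_pi_dist z y i).trans_lt hzy)
  linarith

theorem le_add_of_mem_stdSimplex {x μ : ι → ℝ} {ε : ℝ} (hx : x ∈ stdSimplex ℝ ι) (hμx : μ ≤ x)
    (hμ : 1 ≤ ∑ i, μ i + ε) (j : ι) : x j ≤ μ j + ε := by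
  have hle : x j - μ j ≤ ∑ i, (x i - μ i) :=
    Finset.single_le_sum (f := fun i ↦ x i - μ i) (fun i _ ↦ sub_nonneg.2 (hμx i))
      (Finset.mem_univ j)
  rw [Finset.sum_sub_distrib, hx.2] at hle
  linarith

theorem exists_finset_of_net [DecidableEq ι] [Nonempty ι] {t : Set (ι → ℝ)} [Finite t] {δ : ℝ}
    (hδ : 0 < δ) (htΔ : t ⊆ stdSimplex ℝ ι) (ht : ∀ z ∈ stdSimplex ℝ ι, ∃ y ∈ t, dist z y < δ)
    (c : t → ι) :
    ∃ (σ : Finset t) (μ : ι → ℝ), σ.Nonempty ∧ (∀ y ∈ σ, μ ≤ y) ∧ (∀ i, μ i ≠ 0 → i ∈ σ.image c) ∧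
      1 ≤ ∑ i, (μ i + δ) := by
  obtain ⟨y₀, hy₀, -⟩ := ht _ (single_mem_stdSimplex ℝ (Classical.arbitrary ι))
  have : Nonempty t := ⟨⟨y₀, hy₀⟩⟩
  obtain ⟨C, σ, hσ, hCσ⟩ := exists_dominant_subset_image (fun i (y : t) ↦ (y : ι → ℝ) i) c
  obtain ⟨i₀, -⟩ := hσ ⟨y₀, hy₀⟩
  have hσ_nonempty : σ.Nonempty := Finset.Nonempty.of_image (f := c) ⟨i₀, hCσ i₀.2⟩
  let μ (i : ι) : ℝ := if i ∈ C then σ.inf' hσ_nonempty fun y ↦ (y : ι → ℝ) i else 0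
  have hμ_nonneg (i : ι) : 0 ≤ μ i := by
    by_cases hi : i ∈ C
    · simpa only [μ, if_pos hi] using Finset.le_inf' _ _ fun y _ ↦ (htΔ y.2).1 i
    · simp only [μ, if_neg hi, le_rfl]
  refine ⟨σ, μ, hσ_nonempty, fun y hy i ↦ ?_, fun i hi ↦ hCσ ?_, ?_⟩
  · by_cases hi : i ∈ C
    · simpa only [μ, if_pos hi] using Finset.inf'_le _ hy
    · simpa only [μ, if_neg hi] using (htΔ y.2).1 i
  · by_contra hiC
    simp [μ, hiC] at hi
  · calc 1 ≤ ∑ i ∈ C, (μ i + δ) := by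
          refine one_le_sum_add_of_net hδ ht ⟨i₀, i₀.2⟩ (fun i _ ↦ hμ_nonneg i) fun y hy ↦ ?_
          obtain ⟨i, hi⟩ := hσ ⟨y, hy⟩
          refine ⟨i, i.2, ?_⟩
          simpa only [μ, if_pos i.2] using Finset.le_inf' _ _ hi
      _ ≤ ∑ i, (μ i + δ) :=
          Finset.sum_le_univ_sum_of_nonneg fun i ↦ add_nonneg (hμ_nonneg i) hδ.le

variable [Nonempty ι] {A : ι → Set (ι → ℝ)}

theorem exists_mem_stdSimplex_forall_le_or_mem_cthickening (hA : stdSimplex ℝ ι ⊆ ⋃ i, A i)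
    {ε : ℝ} (hε : 0 < ε) : ∃ x ∈ stdSimplex ℝ ι, ∀ i, x i ≤ ε ∨ x ∈ cthickening ε (A i) := by
  classical
  let δ : ℝ := ε / Fintype.card ι
  have hδ : 0 < δ := div_pos hε (by exact_mod_cast Fintype.card_pos)
  obtain ⟨t, htΔ, htfin, ht⟩ := finite_cover_balls_of_compact (isCompact_stdSimplex ℝ ι) hδ
  have hnet : ∀ z ∈ stdSimplex ℝ ι, ∃ y ∈ t, dist z y < δ := fun z hz ↦ by
    simpa only [Set.mem_iUnion, mem_ball, exists_prop] using ht hz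
  have : Finite t := htfin
  choose c hc using fun y : t ↦ Set.mem_iUnion.1 (hA (htΔ y.2))
  obtain ⟨σ, μ, ⟨x, hx⟩, hμσ, hμc, hμ⟩ := exists_finset_of_net hδ htΔ hnet c
  rw [Finset.sum_add_distrib, Finset.sum_const, Finset.card_univ, nsmul_eq_mul,
    mul_div_cancel₀ _ (by simp)] at hμ
  have hσμ (y : t) (hy : y ∈ σ) := le_add_of_mem_stdSimplex (htΔ y.2) (hμσ y hy) hμ
  refine ⟨x, htΔ x.2, fun i ↦ ?_⟩
  by_cases hi : μ i = 0
  · left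
    simpa only [hi, zero_add] using hσμ x hx i
  · obtain ⟨y, hy, rfl⟩ := Finset.mem_image.1 (hμc i hi)
    refine .inr (mem_cthickening_of_dist_le _ _ _ _ (hc y) ((dist_pi_le_iff hε.le).2 fun j ↦ ?_))
    exact abs_sub_le_iff.2 ⟨by linarith [hσμ x hx j, hμσ y hy j],
      by linarith [hσμ y hy j, hμσ x hx j]⟩

theorem exists_mem_stdSimplex_of_isClosed_cover (hAclosed : ∀ i, IsClosed (A i))
    (hA : stdSimplex ℝ ι ⊆ ⋃ i, A i) : ∃ x ∈ stdSimplex ℝ ι, ∀ i, x i ≠ 0 → x ∈ A i := by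
  let S (ε : Set.Ioi (0 : ℝ)) : Set (ι → ℝ) :=
    stdSimplex ℝ ι ∩ ⋂ i, {x | x i ≤ ε} ∪ cthickening ε (A i)
  have hSclosed (ε : Set.Ioi (0 : ℝ)) : IsClosed (S ε) :=
    (isClosed_stdSimplex ℝ ι).inter <| isClosed_iInter fun i ↦
      (isClosed_le (continuous_apply i) continuous_const).union isClosed_cthickening
  have hSmono : Monotone S := fun ε ε' h ↦ Set.inter_subset_inter_right _ <|
    Set.iInter_mono fun i ↦ Set.union_subset_union
      (Set.ofPred_subset_ofPred.2 fun _ hx ↦ hx.trans h) (cthickening_mono h _)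
  have hSnonempty (ε : Set.Ioi (0 : ℝ)) : (S ε).Nonempty := by
    obtain ⟨x, hx, hxA⟩ := exists_mem_stdSimplex_forall_le_or_mem_cthickening hA ε.2
    exact ⟨x, hx, Set.mem_iInter.2 hxA⟩
  let ε₁ : Set.Ioi (0 : ℝ) := ⟨1, Set.mem_Ioi.2 one_pos⟩
  have : Nonempty (Set.Ioi (0 : ℝ)) := ⟨ε₁⟩
  obtain ⟨x, hx⟩ := IsCompact.nonempty_iInter_of_directed_nonempty_isCompact_isClosed S
    hSmono.directed_ge hSnonempty
    (fun ε ↦ (isCompact_stdSimplex ℝ ι).of_isClosed_subset (hSclosed ε) fun _ hx ↦ hx.1) hSclosed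
  rw [Set.mem_iInter] at hx
  have hxΔ : x ∈ stdSimplex ℝ ι := (hx ε₁).1
  refine ⟨x, hxΔ, fun i hi ↦ ?_⟩
  have hxi : 0 < x i := (hxΔ.1 i).lt_of_ne' hi
  rw [← (hAclosed i).closure_eq, closure_eq_iInter_cthickening' (A i) (Set.Ioo 0 (x i))]
  · exact Set.mem_iInter₂.2 fun ε hε ↦
      (Set.mem_iInter.1 (hx ⟨ε, hε.1⟩).2 i).resolve_left hε.2.not_ge
  · exact fun ε hε ↦ ⟨min (x i / 2) ε,
      ⟨lt_min (half_pos hxi) hε, min_lt_of_left_lt (half_lt_self hxi)⟩,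
      lt_min (half_pos hxi) hε, min_le_right _ _⟩

theorem exists_mem_eq_of_bijOn {X : Type*} [TopologicalSpace X] {K : Set X} (hK : IsCompact K)
    {q G : X → ι → ℝ} (hq : Continuous q) (hqK : Set.BijOn q K (stdSimplex ℝ ι))
    (hG : Continuous G) {y : ι → ℝ} (hsum : ∀ w ∈ K, ∑ j, G w j = ∑ j, y j)
    (hfacet : ∀ w ∈ K, ∀ j, q w j = 0 → G w j ≤ y j) : ∃ w ∈ K, G w = y := by
  let A (j : ι) : Set (ι → ℝ) := q '' (K ∩ {w | G w j ≤ y j})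
  have hAclosed (j : ι) : IsClosed (A j) := by
    refine ((hK.inter_right (isClosed_le ?_ continuous_const)).image hq).isClosed
    exact (continuous_apply j).comp hG
  have hA : stdSimplex ℝ ι ⊆ ⋃ j, A j := fun x hx ↦ by
    obtain ⟨w, hw, rfl⟩ := hqK.surjOn hx
    obtain ⟨j, -, hj⟩ := Finset.exists_le_of_sum_le Finset.univ_nonempty (hsum w hw).le
    exact Set.mem_iUnion.2 ⟨j, w, ⟨hw, hj⟩, rfl⟩
  obtain ⟨x, hx, hxA⟩ := exists_mem_stdSimplex_of_isClosed_cover hAclosed hA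
  obtain ⟨w, hw, rfl⟩ := hqK.surjOn hx
  have hle (j : ι) : G w j ≤ y j := by
    by_cases hj : q w j = 0
    · exact hfacet w hw j hj
    · obtain ⟨w', ⟨hw', hle⟩, hww'⟩ := hxA j hj
      rwa [hqK.injOn hw' hw hww'] at hle
  refine ⟨w, hw, funext fun j ↦ ?_⟩
  exact (Finset.sum_eq_sum_iff_of_le fun j _ ↦ hle j).1 (hsum w hw) j (Finset.mem_univ j)

end Covering

section StdSimplexFace

variable {ι E : Type*} [Fintype ι] [AddCommGroup E] [Module ℝ E] {S : Set ι} {p : ι → E}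

/-- The face of the standard simplex whose vertices are the unit vectors with index in `S`. -/
def stdSimplexFace (S : Set ι) : Set (ι → ℝ) :=
  {w ∈ stdSimplex ℝ ι | ∀ i ∉ S, w i = 0}

theorem stdSimplexFace_univ : stdSimplexFace (Set.univ : Set ι) = stdSimplex ℝ ι := by
  simp [stdSimplexFace]

theorem isCompact_stdSimplexFace (S : Set ι) : IsCompact (stdSimplexFace S) := by
  have hclosed : IsClosed {w : ι → ℝ | ∀ i ∉ S, w i = 0} := by
    simp only [Set.ofPred_forall]
    exact isClosed_iInter fun i ↦ isClosed_iInter fun _ ↦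
      isClosed_eq (continuous_apply i) continuous_const
  exact (isCompact_stdSimplex ℝ ι).inter_right hclosed

theorem convex_stdSimplexFace (S : Set ι) : Convex ℝ (stdSimplexFace S) := by
  intro w hw w' hw' a b ha hb hab
  exact ⟨convex_stdSimplex ℝ ι hw.1 hw'.1 ha hb hab, fun i hi ↦ by simp [hw.2 i hi, hw'.2 i hi]⟩

theorem image_linearCombination_stdSimplexFace (p : ι → E) (S : Set ι) :
    Fintype.linearCombination ℝ p '' stdSimplexFace S = convexHull ℝ (p '' S) := by
  classical
  refine subset_antisymm ?_ (convexHull_min ?_ ((convex_stdSimplexFace S).linear_image _))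
  · rintro _ ⟨w, ⟨hw, hwS⟩, rfl⟩
    rw [Fintype.linearCombination_apply, ← finsum_eq_sum_of_fintype]
    refine (convex_convexHull ℝ _).finsum_mem hw.1 ?_ fun i hi ↦ ?_
    · rw [finsum_eq_sum_of_fintype, hw.2]
    · exact subset_convexHull ℝ _ ⟨i, by_contra fun h ↦ hi (hwS i h), rfl⟩
  · rintro _ ⟨i, hi, rfl⟩
    refine ⟨Pi.single i 1, ⟨single_mem_stdSimplex ℝ i, fun j hj ↦ ?_⟩, by simp⟩
    exact Pi.single_eq_of_ne (ne_of_mem_of_not_mem hi hj).symm 1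

theorem injOn_linearCombination_stdSimplexFace (hp : AffineIndependent ℝ fun i : S ↦ p i) :
    Set.InjOn (Fintype.linearCombination ℝ p) (stdSimplexFace S) := by
  classical
  intro w hw w' hw' heq
  have hoff (i : ι) (hi : i ∉ Set.range ((↑) : S → ι)) : (w - w') i = 0 := by
    rw [Subtype.range_coe] at hi
    simp [hw.2 i hi, hw'.2 i hi]
  have hsum : ∑ i : S, (w - w') i = 0 := by
    rw [Fintype.sum_of_injective _ Subtype.val_injective _ (w - w') hoff fun _ ↦ rfl]
    simp [hw.1.2, hw'.1.2]
  have hcomb : ∑ i : S, (w - w') i • p i = 0 := by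
    rw [Fintype.sum_of_injective _ Subtype.val_injective _ (fun i ↦ (w - w') i • p i)
      (fun i hi ↦ by rw [hoff i hi, zero_smul]) fun _ ↦ rfl]
    rw [← Fintype.linearCombination_apply, map_sub, heq, sub_self]
  refine sub_eq_zero.1 (funext fun i ↦ ?_)
  by_cases hi : i ∈ S
  · exact hp.eq_zero_of_sum_eq_zero hsum hcomb ⟨i, hi⟩ (Finset.mem_univ _)
  · exact hoff i (by rwa [Subtype.range_coe])

theorem bijOn_linearCombination_stdSimplex (hp : AffineIndependent ℝ p) :
    Set.BijOn (Fintype.linearCombination ℝ p) (stdSimplex ℝ ι) (convexHull ℝ (Set.range p)) := by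
  have hinj := injOn_linearCombination_stdSimplexFace (S := Set.univ)
    (hp.comp_embedding (Function.Embedding.subtype _))
  rw [← stdSimplexFace_univ, ← Set.image_univ, ← image_linearCombination_stdSimplexFace]
  exact hinj.bijOn_image

end StdSimplexFace

section Realization

open Geometry

variable {ι E : Type*} [AddCommGroup E] [Module ℝ E] {T : SimplicialComplex ℝ E}

theorem finite_vertices (hT : T.faces.Finite) : T.vertices.Finite :=
  hT.preimage Finset.singleton_injective.injOn

theorem coe_subset_vertices {σ : Finset E} (hσ : σ ∈ T.faces) : (σ : Set E) ⊆ T.vertices := by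
  rw [T.vertices_eq]
  exact Set.subset_biUnion_of_mem (u := fun σ : Finset E ↦ (σ : Set E)) hσ

theorem affineIndependent_preimage_coe {σ : Finset E} (hσ : σ ∈ T.faces) :
    AffineIndependent ℝ
      fun v : ((↑) ⁻¹' (σ : Set E) : Set T.vertices) ↦ ((v : T.vertices) : E) := by
  let e : ((↑) ⁻¹' (σ : Set E) : Set T.vertices) ↪ σ :=
    ⟨fun v ↦ ⟨v.1, v.2⟩, fun _ _ h ↦ Subtype.ext (Subtype.ext (congrArg (fun v : σ ↦ (v : E)) h))⟩
  exact (T.indep hσ).comp_embedding e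

variable [Fintype T.vertices]

/-- The geometric realization of `T` in the standard simplex spanned by its vertices, i.e. the set
of barycentric coordinates of the points of `T`. -/
def realization (T : SimplicialComplex ℝ E) [Fintype T.vertices] : Set (T.vertices → ℝ) :=
  ⋃ σ ∈ T.faces, stdSimplexFace ((↑) ⁻¹' (σ : Set E))

theorem mem_realization {w : T.vertices → ℝ} :
    w ∈ realization T ↔ ∃ σ ∈ T.faces, w ∈ stdSimplexFace ((↑) ⁻¹' (σ : Set E)) := by
  simp [realization]

theorem isCompact_realization (hT : T.faces.Finite) : IsCompact (realization T) :=
  hT.isCompact_biUnion fun _ _ ↦ isCompact_stdSimplexFace _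

theorem realization_subset_stdSimplex : realization T ⊆ stdSimplex ℝ T.vertices :=
  Set.iUnion₂_subset fun _ _ ↦ Set.sep_subset _ _

theorem image_linearCombination_stdSimplexFace_preimage {s : Set E} (hs : s ⊆ T.vertices) :
    Fintype.linearCombination ℝ ((↑) : T.vertices → E) '' stdSimplexFace ((↑) ⁻¹' s) =
      convexHull ℝ s := by
  rw [image_linearCombination_stdSimplexFace, Subtype.image_preimage_coe,
    Set.inter_eq_self_of_subset_right hs]

theorem bijOn_linearCombination_realization (T : SimplicialComplex ℝ E) [Fintype T.vertices] :
    Set.BijOn (Fintype.linearCombination ℝ ((↑) : T.vertices → E)) (realization T) T.space := by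
  have himage : Fintype.linearCombination ℝ ((↑) : T.vertices → E) '' realization T = T.space := by
    simp only [realization, Set.image_iUnion₂, SimplicialComplex.space]
    exact Set.iUnion₂_congr fun σ hσ ↦
      image_linearCombination_stdSimplexFace_preimage (coe_subset_vertices hσ)
  have hinj {σ : Finset E} (hσ : σ ∈ T.faces) :
      Set.InjOn (Fintype.linearCombination ℝ ((↑) : T.vertices → E))
        (stdSimplexFace ((↑) ⁻¹' (σ : Set E))) :=
    injOn_linearCombination_stdSimplexFace (affineIndependent_preimage_coe hσ)
  rw [← himage]
  refine Set.InjOn.bijOn_image fun w hw w' hw' heq ↦ ?_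
  obtain ⟨σ, hσ, hw⟩ := mem_realization.1 hw
  obtain ⟨τ, hτ, hw'⟩ := mem_realization.1 hw'
  have hστ : (σ ∩ τ : Set E) ⊆ T.vertices := Set.inter_subset_left.trans (coe_subset_vertices hσ)
  have hmem : Fintype.linearCombination ℝ ((↑) : T.vertices → E) w ∈
      convexHull ℝ (σ ∩ τ : Set E) := by
    rw [← T.convexHull_inter_convexHull hσ hτ]
    exact ⟨image_linearCombination_stdSimplexFace_preimage (coe_subset_vertices hσ) ▸ ⟨w, hw, rfl⟩,
      image_linearCombination_stdSimplexFace_preimage (coe_subset_vertices hτ) ▸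
        ⟨w', hw', heq.symm⟩⟩
  rw [← image_linearCombination_stdSimplexFace_preimage hστ] at hmem
  obtain ⟨u, ⟨hu, huστ⟩, huw⟩ := hmem
  have huσ : u = w := hinj hσ ⟨hu, fun v hv ↦ huστ v fun h ↦ hv h.1⟩ hw huw
  have huτ : u = w' := hinj hτ ⟨hu, fun v hv ↦ huστ v fun h ↦ hv h.2⟩ hw' (huw.trans heq)
  exact huσ.symm.trans huτ

theorem bijOn_linearCombination_barycentric [Fintype ι] {p : ι → E} (hp : AffineIndependent ℝ p)
    (hspace : T.space = convexHull ℝ (Set.range p)) {s : T.vertices → ι → ℝ}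
    (hs : ∀ v, s v ∈ stdSimplex ℝ ι) (hsp : ∀ v, Fintype.linearCombination ℝ p (s v) = v) :
    Set.BijOn (Fintype.linearCombination ℝ s) (realization T) (stdSimplex ℝ ι) := by
  have hp_bij := bijOn_linearCombination_stdSimplex hp
  have hT_bij := bijOn_linearCombination_realization T
  rw [hspace] at hT_bij
  have hcomp (w : T.vertices → ℝ) :
      Fintype.linearCombination ℝ p (Fintype.linearCombination ℝ s w) =
        Fintype.linearCombination ℝ ((↑) : T.vertices → E) w := by
    simp only [Fintype.linearCombination_apply ℝ s, Fintype.linearCombination_apply ℝ Subtype.val,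
      map_sum, map_smul, hsp]
  have hmaps : Set.MapsTo (Fintype.linearCombination ℝ s) (realization T) (stdSimplex ℝ ι) := by
    intro w hw
    obtain ⟨hw_nonneg, hw_sum⟩ := realization_subset_stdSimplex hw
    rw [Fintype.linearCombination_apply]
    exact (convex_stdSimplex ℝ ι).sum_mem (fun v _ ↦ hw_nonneg v) hw_sum fun v _ ↦ hs v
  refine ⟨hmaps, fun w hw w' hw' heq ↦ hT_bij.injOn hw hw' ?_, fun x hx ↦ ?_⟩
  · rw [← hcomp, ← hcomp, heq]
  · obtain ⟨w, hw, hwx⟩ := hT_bij.surjOn (hp_bij.mapsTo hx)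
    exact ⟨w, hw, hp_bij.injOn (hmaps hw) hx ((hcomp w).trans hwx)⟩

end Realization

section Transport

open Geometry

variable {ι κ E : Type*} [Fintype ι] [Fintype κ] [AddCommGroup E] [Module ℝ E]
  {T : SimplicialComplex ℝ E} {p : ι → E}

theorem linearMap_apply_eq_zero_of_linearCombination_apply_eq_zero [Fintype T.vertices]
    {s : T.vertices → ι → ℝ} (hs : ∀ v, s v ∈ stdSimplex ℝ ι)
    (hsp : ∀ v, Fintype.linearCombination ℝ p (s v) = v) {lab : T.vertices → ι}
    (hlab : ∀ (v : T.vertices) (S : Set ι), (v : E) ∈ convexHull ℝ (p '' S) → lab v ∈ S)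
    {w : T.vertices → ℝ} (hw : 0 ≤ w) {j : ι} (hj : Fintype.linearCombination ℝ s w j = 0) :
    FunOnFinite.linearMap ℝ ℝ lab w j = 0 := by
  classical
  rw [FunOnFinite.linearMap_apply_apply]
  refine Finset.sum_eq_zero fun v hv ↦ ?_
  simp only [Fintype.linearCombination_apply, Finset.sum_apply, Pi.smul_apply, smul_eq_mul] at hj
  have hterm := (Finset.sum_eq_zero_iff_of_nonneg fun v _ ↦ mul_nonneg (hw v) ((hs v).1 j)).1 hj v
    (Finset.mem_univ v)
  refine (mul_eq_zero.1 hterm).resolve_right fun hsv ↦ ?_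
  have hface : (v : E) ∈ convexHull ℝ (p '' {j}ᶜ) := by
    rw [← image_linearCombination_stdSimplexFace]
    refine ⟨s v, ⟨hs v, fun i hi ↦ ?_⟩, hsp v⟩
    obtain rfl : i = j := by simpa using hi
    exact hsv
  exact hlab v _ hface (Finset.mem_filter.1 hv).2

theorem exists_mem_faces_exists_transport [Nonempty ι] (hp : AffineIndependent ℝ p)
    (hT : T.faces.Finite) (hspace : T.space = convexHull ℝ (Set.range p))
    {lab : κ → T.vertices → ι}
    (hlab : ∀ i (v : T.vertices) (S : Set ι), (v : E) ∈ convexHull ℝ (p '' S) → lab i v ∈ S)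
    {r : κ → ℝ} {y : ι → ℝ} (hr : 0 ≤ r) (hy : 0 ≤ y) (hry : ∑ i, r i = ∑ j, y j) :
    ∃ σ ∈ T.faces, ∃ M : κ → ι → ℝ, 0 ≤ M ∧ (∀ i, ∑ j, M i j = r i) ∧ (∀ j, ∑ i, M i j = y j) ∧
      ∀ i j, M i j ≠ 0 → ∃ v : T.vertices, (v : E) ∈ σ ∧ lab i v = j := by
  classical
  have := (finite_vertices hT).fintype
  have hbary (v : T.vertices) : ∃ s ∈ stdSimplex ℝ ι, Fintype.linearCombination ℝ p s = v :=
    (bijOn_linearCombination_stdSimplex hp).surjOn (hspace ▸ T.vertices_subset_space v.2)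
  choose s hs hsp using hbary
  let M (w : T.vertices → ℝ) (i : κ) (j : ι) : ℝ := r i * FunOnFinite.linearMap ℝ ℝ (lab i) w j
  have hrow (w) (hw : w ∈ realization T) (i : κ) : ∑ j, M w i j = r i := by
    have := stdSimplex.image_linearMap (lab i) ⟨w, realization_subset_stdSimplex hw, rfl⟩
    rw [← Finset.mul_sum, this.2, mul_one]
  have htotal (w) (hw : w ∈ realization T) : ∑ j, ∑ i, M w i j = ∑ j, y j := by
    rw [Finset.sum_comm, ← hry]
    exact Finset.sum_congr rfl fun i _ ↦ hrow w hw i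
  have hfacet (w) (hw : w ∈ realization T) (j : ι) (hj : Fintype.linearCombination ℝ s w j = 0) :
      ∑ i, M w i j = 0 :=
    Finset.sum_eq_zero fun i _ ↦ mul_eq_zero_of_right _ <|
      linearMap_apply_eq_zero_of_linearCombination_apply_eq_zero hs hsp (hlab i)
        (realization_subset_stdSimplex hw).1 hj
  have hcont : Continuous fun w j ↦ ∑ i, M w i j :=
    continuous_pi fun j ↦ continuous_finsetSum _ fun i _ ↦ continuous_const.mul <|
      (continuous_apply j).comp (FunOnFinite.continuous_linearMap ℝ ℝ (lab i))
  obtain ⟨w, hw, hcol⟩ := exists_mem_eq_of_bijOn (isCompact_realization hT)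
    (LinearMap.continuous_of_finiteDimensional _)
    (bijOn_linearCombination_barycentric hp hspace hs hsp) hcont htotal
    fun w hw j hj ↦ (hfacet w hw j hj).trans_le (hy j)
  obtain ⟨σ, hσ, hwΔ, hwσ⟩ := mem_realization.1 hw
  refine ⟨σ, hσ, M w, fun i j ↦ mul_nonneg (hr i) ?_, hrow w hw, congrFun hcol, fun i j hij ↦ ?_⟩
  · exact (stdSimplex.image_linearMap (lab i) ⟨w, hwΔ, rfl⟩).1 j
  · have hij' := right_ne_zero_of_mul hij
    rw [FunOnFinite.linearMap_apply_apply] at hij'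
    obtain ⟨v, hv, hwv⟩ := Finset.exists_ne_zero_of_sum_ne_zero hij'
    exact ⟨v, by_contra fun h ↦ hwv (hwσ v h), (Finset.mem_filter.1 hv).2⟩

theorem le_ncard_of_lt_sum {b : ι → ℝ} {S : Set ι} {k : ℕ} (hb : ∀ j, b j ≤ 1)
    (hbS : ∀ j, b j ≠ 0 → j ∈ S) (hk : k - 1 < ∑ j, b j) : k ≤ S.ncard := by
  classical
  have hsum : ∑ j, b j ≤ S.ncard := by
    rw [Set.ncard_eq_toFinset_card', ← Finset.sum_subset S.toFinset.subset_univ fun j _ hj ↦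
      by_contra fun h ↦ hj (Set.mem_toFinset.2 (hbS j h))]
    simpa using Finset.sum_le_card_nsmul S.toFinset b 1 fun j _ ↦ hb j
  have hlt : (k : ℝ) < S.ncard + 1 := by linarith
  exact Nat.lt_succ_iff.1 (by exact_mod_cast hlt)

variable [Nonempty ι]

theorem exists_mem_faces_forall_le_ncard_labels (hp : AffineIndependent ℝ p)
    (hT : T.faces.Finite) (hspace : T.space = convexHull ℝ (Set.range p))
    {lab : κ → T.vertices → ι}
    (hlab : ∀ i (v : T.vertices) (S : Set ι), (v : E) ∈ convexHull ℝ (p '' S) → lab i v ∈ S)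
    {k : κ → ℕ} (hk : ∀ i, 0 < k i) (hsum : ∑ i, k i = Fintype.card κ + Fintype.card ι - 1) :
    ∃ σ ∈ T.faces, ∀ i, k i ≤ {j | ∃ v : T.vertices, (v : E) ∈ σ ∧ lab i v = j}.ncard := by
  set m := (Fintype.card κ : ℝ) with hm
  set n := (Fintype.card ι : ℝ) with hn
  have hm_nonneg : 0 ≤ m := Nat.cast_nonneg _
  have hn_one : 1 ≤ n := Nat.one_le_cast.2 Fintype.card_pos
  have hsum' : ∑ i, (k i : ℝ) = m + n - 1 := by
    rw [← Nat.cast_sum, hsum, Nat.cast_pred (Nat.add_pos_right _ Fintype.card_pos), Nat.cast_add]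
  have hr_pos : 0 < 1 / (m + 1) := by positivity
  have hy_le : 1 / (n * (m + 1)) ≤ 1 := by
    rw [div_le_one (by positivity)]
    nlinarith
  obtain ⟨σ, hσ, M, hM, hrow, hcol, hsupp⟩ := exists_mem_faces_exists_transport hp hT hspace hlab
    (r := fun i ↦ k i - 1 + 1 / (m + 1)) (y := fun _ ↦ 1 - 1 / (n * (m + 1)))
    (fun i ↦ add_nonneg (sub_nonneg.2 (Nat.one_le_cast.2 (hk i))) hr_pos.le)
    (fun _ ↦ sub_nonneg.2 hy_le) (by
      simp only [Finset.sum_add_distrib, Finset.sum_sub_distrib, hsum', Finset.sum_const,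
        Finset.card_univ, nsmul_eq_mul, ← hm, ← hn]
      field_simp
      ring)
  refine ⟨σ, hσ, fun i ↦ le_ncard_of_lt_sum (fun j ↦ ?_) (hsupp i) ?_⟩
  · calc M i j ≤ ∑ i, M i j := Finset.single_le_sum (fun i _ ↦ hM i j) (Finset.mem_univ i)
      _ ≤ 1 := by rw [hcol]; exact sub_le_self _ (by positivity)
  · rw [hrow]
    exact lt_add_of_pos_right _ hr_pos

theorem exists_mem_faces_forall_le_ncard_labelings (hp : AffineIndependent ℝ p)
    (hT : T.faces.Finite) (hspace : T.space = convexHull ℝ (Set.range p))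
    {lab : κ → T.vertices → ι}
    (hlab : ∀ i (v : T.vertices) (S : Set ι), (v : E) ∈ convexHull ℝ (p '' S) → lab i v ∈ S)
    {l : ι → ℕ} (hl : ∀ j, 0 < l j) (hsum : ∑ j, l j = Fintype.card κ + Fintype.card ι - 1) :
    ∃ τ ∈ T.faces, ∀ j, l j ≤ {i | ∃ v : T.vertices, (v : E) ∈ τ ∧ lab i v = j}.ncard := by
  set m := (Fintype.card κ : ℝ) with hm
  set n := (Fintype.card ι : ℝ) with hn
  have hn_pos : 0 < n := Nat.cast_pos.2 Fintype.card_pos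
  have hsum' : ∑ j, (l j : ℝ) = m + n - 1 := by
    rw [← Nat.cast_sum, hsum, Nat.cast_pred (Nat.add_pos_right _ Fintype.card_pos), Nat.cast_add]
  obtain ⟨τ, hτ, M, hM, hrow, hcol, hsupp⟩ := exists_mem_faces_exists_transport hp hT hspace hlab
    (r := 1) (y := fun j ↦ l j - 1 + 1 / n) zero_le_one
    (fun j ↦ add_nonneg (sub_nonneg.2 (Nat.one_le_cast.2 (hl j))) (by positivity)) (by
      simp only [Finset.sum_add_distrib, Finset.sum_sub_distrib, hsum', Finset.sum_const,
        Finset.card_univ, nsmul_eq_mul, Pi.one_apply, ← hm, ← hn]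
      field_simp
      ring)
  refine ⟨τ, hτ, fun j ↦ le_ncard_of_lt_sum (b := fun i ↦ M i j) (fun i ↦ ?_)
    (fun i ↦ hsupp i j) ?_⟩
  · exact (Finset.single_le_sum (fun j _ ↦ hM i j) (Finset.mem_univ j)).trans (hrow i).le
  · rw [hcol]
    exact lt_add_of_pos_right _ (by positivity)

end Transport

end MultiSperner

open MultiSperner in
theorem mainTheorem8_general {ι κ E : Type*} [Fintype ι] [Fintype κ] [Nonempty ι] [AddCommGroup E]
    [Module ℝ E] {p : ι → E} (hp : AffineIndependent ℝ p) {T : Geometry.SimplicialComplex ℝ E}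
    (hT : T.faces.Finite) (hspace : T.space = convexHull ℝ (Set.range p))
    {lab : κ → T.vertices → ι}
    (hlab : ∀ i (v : T.vertices) (S : Set ι), (v : E) ∈ convexHull ℝ (p '' S) → lab i v ∈ S) :
    (∀ k : κ → ℕ, (∀ i, 0 < k i) → ∑ i, k i = Fintype.card κ + Fintype.card ι - 1 →
      ∃ σ ∈ T.faces, ∀ i, k i ≤ {j | ∃ v : T.vertices, (v : E) ∈ σ ∧ lab i v = j}.ncard) ∧
    (∀ l : ι → ℕ, (∀ j, 0 < l j) → ∑ j, l j = Fintype.card κ + Fintype.card ι - 1 →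
      ∃ τ ∈ T.faces, ∀ j, l j ≤ {i | ∃ v : T.vertices, (v : E) ∈ τ ∧ lab i v = j}.ncard) :=
  ⟨fun _ hk hsum ↦ exists_mem_faces_forall_le_ncard_labels hp hT hspace hlab hk hsum,
    fun _ hl hsum ↦ exists_mem_faces_forall_le_ncard_labelings hp hT hspace hlab hl hsum⟩

theorem mainTheorem8 {E : Type*} [NormedAddCommGroup E] [InnerProductSpace ℝ E]
    [FiniteDimensional ℝ E] {n m : ℕ} (hn : 1 ≤ n)
    (p : Fin n → E) (hp : AffineIndependent ℝ p)
    (T : Geometry.SimplicialComplex ℝ E)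
    (hT : MultiSperner.IsTriangulation T (convexHull ℝ (Set.range p)))
    (lab : Fin m → T.vertices → Fin n)
    (hlab : ∀ i, MultiSperner.IsSpernerLabeling p T (lab i)) :
    (∀ k : Fin m → ℕ, (∀ i, 0 < k i) → ∑ i, k i = m + n - 1 →
      ∃ σ ∈ T.faces, ∀ i, k i ≤ (MultiSperner.labelsOn (lab i) σ).ncard) ∧
    (∀ l : Fin n → ℕ, (∀ j, 0 < l j) → ∑ j, l j = m + n - 1 →
      ∃ τ ∈ T.faces, ∀ j, l j ≤ {i : Fin m | j ∈ MultiSperner.labelsOn (lab i) τ}.ncard) := by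
  have : Nonempty (Fin n) := Fin.pos_iff_nonempty.1 hn
  simpa only [Fintype.card_fin, MultiSperner.labelsOn, Set.mem_ofPred_eq] using
    mainTheorem8_general hp hT.finite_faces hT.space_eq hlab
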